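/- For positive functions write $f(\rho)\doteq g(\rho)$ if $\log f(\rho)/\log\rho$ and $\log g(\rho)/\log\rho$ converge to the same limit as $\rho\to\infty$, and $f(\rho)\mathrel{\dot\ge}\rho^{s}$ if $\liminf_{\rho\to\infty}\log f(\rho)/\log\rho\ge s$. Consider the two-user single-antenna Rayleigh-fading interference channel $$y_i=\sqrt{\rho}\,h_{ii}x_i+\sqrt{\rho^{\alpha}}\,h_{ji}x_j+z_i,\qquad \{i,j\}=\{1,2\},$$ with signal-to-noise ratio $\rho$ and very strong interference, $\alpha\ge 2$, where for each receiver $i$ the fading coefficients $h_{ii},h_{ji}$ and the noise $z_i$ are independent $\mathcal{CN}(0,1)$ random variables, independent of the transmitted symbols; receiver $i$ knows $h_{ii},h_{ji}$. Let $0\le r_1,r_2\le 1$. For every $\rho$, user $i$ transmits a symbol $x_i$ drawn uniformly (and independently of the other user) from a finite non-empty codebook $\mathcal X_i(\rho)\subset\{x\in\mathbb C:|x|^2\le 1\}$ of multiplexing rate $r_i$, i.e. $|\mathcal X_i(\rho)|\doteq\rho^{r_i}$; for all large $\rho$ at least one of the two codebooks has at least two elements. A stripping decoder at receiver $i$ first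 makes a maximum-likelihood (ML) decision $\bar x_j\in\mathcal X_j(\rho)$ on the interfering symbol, treating the intended signal as noise (either as Gaussian noise, so that the effective noise is $\mathcal{CN}(0,1+\rho|h_{ii}|^2)$, or as noise with its true law, induced by the uniform law of $x_i$ on $\mathcal X_i(\rho)$), then forms $y_i-\sqrt{\rho^\alpha}\,h_{ji}\bar x_j$, and finally makes an ML decision on $x_i$ from this signal as if the interference had been removed perfectly. Ties are broken in an arbitrary measurable way. Let $P(E_{ii})$ be the probability, averaged over symbols, noise and fading, that its output differs from $x_i$, and let $P(E)=\max\{P(E_{11}),P(E_{22})\}$. Suppose that for some $\epsilon\ge 0$ the minimum squared distances satisfy, for $i=1,2$, $$\min_{x\ne x'\in\mathcal X_i(\rho)}|x-x'|^2\mathrel{\dot\ge}\rho^{-r_i+\epsilon}$$ (the minimum over an empty set being $+\infty$). Then the stripping decoder achieves the diversity-multiplexing tradeoff outer bound: $$P(E)\doteq\rho^{-\min\{(1-r_1)^+,(1-r_2)^+\}}.$$ The same exponential equality holds when $P(E_{ii})$ is replaced by the error probability of the second stage under the assumption that the interference has been decoded correctly and removed. -/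

import Mathlib

open MeasureTheory Filter Topology

noncomputable section

namespace FadingIC

/-- Density (with respect to Lebesgue measure on `ℂ`) of the circularly symmetric complex
Gaussian law `𝒞𝒩(0, v)` of variance `v > 0`. -/
def cnDensity (v : ℝ) (z : ℂ) : ℝ :=
  (Real.pi * v)⁻¹ * Real.exp (-‖z‖ ^ 2 / v)

/-- The law `𝒞𝒩(0, 1)`. -/
def cn : Measure ℂ :=
  volume.withDensity fun z => ENNReal.ofReal (cnDensity 1 z)

/-- Exponential equality `f ≐ g`: for large `ρ` both functions are positive (so that the logarithms
are genuine), and `log f(ρ) / log ρ` and `log g(ρ) / log ρ` converge to one common limit. -/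
def ExpEq (f g : ℝ → ℝ) : Prop :=
  (∀ᶠ ρ in atTop, 0 < f ρ) ∧ (∀ᶠ ρ in atTop, 0 < g ρ) ∧
    ∃ c : ℝ, Tendsto (fun ρ => Real.log (f ρ) / Real.log ρ) atTop (𝓝 c) ∧
      Tendsto (fun ρ => Real.log (g ρ) / Real.log ρ) atTop (𝓝 c)

/-- A family of scalar codebooks, one for each SNR value `ρ`, of multiplexing rate `r` and subject
to the power constraint `|x|² ≤ 1`. The number of codewords is `ρ ^ r` to exponential order, since
`ρ ^ r` need not be an integer. -/
structure IsCodebookFamily (r : ℝ) (C : ℝ → Finset ℂ) : Prop where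
  nonempty : ∀ ρ, (C ρ).Nonempty
  power : ∀ ρ, ∀ x ∈ C ρ, ‖x‖ ^ 2 ≤ 1
  card : ExpEq (fun ρ => ((C ρ).card : ℝ)) (fun ρ => ρ ^ r)

/-- `|x - x'|² ≥̇ ρ ^ s` for every pair of distinct codewords, that is, the minimum squared
distance `d(ρ)` of the codebook has `liminf log d(ρ) / log ρ ≥ s`. -/
def MinDistExpGe (C : ℝ → Finset ℂ) (s : ℝ) : Prop :=
  ∀ δ > 0, ∀ᶠ ρ in atTop, ∀ x ∈ C ρ, ∀ x' ∈ C ρ, x ≠ x' → ρ ^ (s - δ) ≤ ‖x - x'‖ ^ 2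

/-- `x` is a maximum-likelihood decision from the codebook `C` for the likelihood function `L`. -/
def IsMLDecision (C : Finset ℂ) (L : ℂ → ℝ) (x : ℂ) : Prop :=
  x ∈ C ∧ ∀ x' ∈ C, L x' ≤ L x

/-- The two standard ways to treat the intended signal as noise: as Gaussian noise of the same
power, or as noise with its true law, the uniform law on the intended codebook. -/
inductive NoiseModel
  | gaussian
  | exact

/-- Likelihood of the interfering symbol `b` given the received signal `y`, when the intended signal
(codebook `A`) is treated as noise; `g` is the direct and `k` the cross fading coefficient. -/
def interfererLikelihood (ρ α : ℝ) (A : Finset ℂ) (g k y b : ℂ) : NoiseModel → ℝ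
  | .gaussian => cnDensity (1 + ρ * ‖g‖ ^ 2) (y - (√(ρ ^ α) : ℂ) * k * b)
  | .exact => (A.card : ℝ)⁻¹ *
      ∑ a ∈ A, cnDensity 1 (y - (√(ρ ^ α) : ℂ) * k * b - (√ρ : ℂ) * g * a)

/-- A stripping decoder at one receiver, with intended codebook `A` and interfering codebook `B`.
Both stages know the fading coefficients `g` (direct) and `k` (cross) that they use; ties in the ML
rules may be broken in any measurable way. -/
structure StrippingDecoder (m : NoiseModel) (ρ α : ℝ) (A B : Finset ℂ) where
  /-- First stage: `(g, k, y)` is mapped to the decoded interfering symbol. -/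
  interferer : ℂ × ℂ × ℂ → ℂ
  measurable_interferer : Measurable interferer
  interferer_ml : ∀ g k y,
    IsMLDecision B (fun b => interfererLikelihood ρ α A g k y b m) (interferer (g, k, y))
  /-- Second stage: `(g, y')` is mapped to the decoded intended symbol, where `y'` is the received
  signal after subtraction of the interference. -/
  intended : ℂ × ℂ → ℂ
  measurable_intended : Measurable intended
  intended_ml : ∀ g y',
    IsMLDecision A (fun a => cnDensity 1 (y' - (√ρ : ℂ) * g * a)) (intended (g, y'))

namespace StrippingDecoder

variable {m : NoiseModel} {ρ α : ℝ} {A B : Finset ℂ}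

/-- Output of the stripping decoder: decode the interference, subtract it, decode the intended
symbol. -/
def output (D : StrippingDecoder m ρ α A B) (g k y : ℂ) : ℂ :=
  D.intended (g, y - (√(ρ ^ α) : ℂ) * k * D.interferer (g, k, y))

/-- Error probability of the stripping decoder given the fading coefficients, for independent
uniformly distributed symbols `a`, `b` and noise `z ∼ 𝒞𝒩(0, 1)`; the received signal is
`√ρ g a + √(ρ ^ α) k b + z`. -/
def condError (D : StrippingDecoder m ρ α A B) (g k : ℂ) : ℝ :=
  ((A.card : ℝ) * B.card)⁻¹ * ∑ a ∈ A, ∑ b ∈ B,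
    cn.real {z | D.output g k ((√ρ : ℂ) * g * a + (√(ρ ^ α) : ℂ) * k * b + z) ≠ a}

/-- Error probability of the stripping decoder, averaged over independent `𝒞𝒩(0, 1)` fading. -/
def error (D : StrippingDecoder m ρ α A B) : ℝ :=
  ∫ h : ℂ × ℂ, D.condError h.1 h.2 ∂(cn.prod cn)

/-- Average error probability of the second stage when the interference has been decoded correctly
and removed, so that its input is `√ρ g a + z`. -/
def errorNoInterference (D : StrippingDecoder m ρ α A B) : ℝ :=
  ∫ g : ℂ, (A.card : ℝ)⁻¹ * ∑ a ∈ A,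
    cn.real {z | D.intended (g, (√ρ : ℂ) * g * a + z) ≠ a} ∂cn

end StrippingDecoder

end FadingIC

end

open FadingIC

namespace FadingIC

/-! ### The complex Gaussian law -/

/-! The error is governed by deep fades of the direct link, both below and above; write $N$ for the
size of the intended codebook.

Converse: if $\rho|g|^2\le N/400$, the scaled constellation lies in a disc too small for $N\ge 2$
decision regions, so every decoder errs with probability bounded below (`le_average_error`, a
packing argument). Such a fade has probability of order $\min(1,N/\rho)$. The user with the larger
rate therefore forces $P\mathrel{\dot\ge}\rho^{-(1-\max(r_1,r_2))}$, whatever its decoder.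

Achievability: an error needs a wrong decision on the interferer or a wrong second-stage decision on
the stripped signal. A wrong second stage forces $\rho\Delta|g|^2\le 4|z|^2$
(`sq_norm_le_of_intended_ne`). A wrong first stage forces
$\rho^\alpha\Delta'|k|^2\lesssim\rho|g|^2+|z|^2+N$ (`sq_norm_le_of_interferer_ne`), for either noise
model. Chernoff bounds over $z$ and exact Gaussian integrals over $g,k$ give `error_le`, a bound by
constants times $1/(\rho\Delta)$ and $(\rho+N)/(\rho^\alpha\Delta')$. With
$\Delta\mathrel{\dot\ge}\rho^{-r}$, $\Delta'\mathrel{\dot\ge}\rho^{-s}$ and $\alpha\ge 2$, these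
have exponents at most $-(1-r)$ and $-(1-s)$. -/

theorem cnDensity_one_nonneg (z : ℂ) : 0 ≤ cnDensity 1 z := by
  unfold cnDensity; positivity

theorem continuous_cnDensity_one : Continuous (cnDensity 1) := by
  unfold cnDensity; fun_prop

theorem measurable_ofReal_cnDensity_one :
    Measurable fun z => ENNReal.ofReal (cnDensity 1 z) :=
  continuous_cnDensity_one.measurable.ennreal_ofReal

theorem norm_le_of_cnDensity_le {v : ℝ} (hv : 0 < v) {z w : ℂ}
    (h : cnDensity v z ≤ cnDensity v w) : ‖w‖ ≤ ‖z‖ := by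
  unfold cnDensity at h
  have h1 := le_of_mul_le_mul_left h (by positivity : 0 < (Real.pi * v)⁻¹)
  rw [Real.exp_le_exp, div_le_div_iff_of_pos_right hv] at h1
  exact (sq_le_sq₀ (norm_nonneg _) (norm_nonneg _)).1 (by linarith)

theorem integral_exp_neg_mul_sq_norm_complex {b : ℝ} (hb : 0 < b) :
    ∫ z : ℂ, Real.exp (-b * ‖z‖ ^ 2) = Real.pi / b := by
  rw [GaussianFourier.integral_rexp_neg_mul_sq_norm hb]
  simp

theorem exp_mul_cnDensity_one (c : ℝ) (z : ℂ) :
    cnDensity 1 z * Real.exp (-c * ‖z‖ ^ 2) =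
      Real.pi⁻¹ * Real.exp (-(1 + c) * ‖z‖ ^ 2) := by
  unfold cnDensity
  rw [mul_assoc, ← Real.exp_add]
  congr 2 <;> ring

/-- The one Gaussian computation everything rests on: $c=0$ is normalization, $c=-1/2$ the Chernoff
moment, and $c>0$ the average over Rayleigh fading, where exponential decay in $|g|^2$ becomes the
polynomial $1/(1+c)$. -/
theorem integral_exp_cn {c : ℝ} (hc : -1 < c) :
    ∫ z, Real.exp (-c * ‖z‖ ^ 2) ∂cn = (1 + c)⁻¹ := by
  have hc' : 0 < 1 + c := by linarith
  unfold cn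
  rw [integral_withDensity_eq_integral_toReal_smul measurable_ofReal_cnDensity_one (by simp)]
  simp only [ENNReal.toReal_ofReal (cnDensity_one_nonneg _), smul_eq_mul, exp_mul_cnDensity_one]
  rw [integral_const_mul, integral_exp_neg_mul_sq_norm_complex hc']
  field_simp

theorem integrable_exp_cn {c : ℝ} (hc : -1 < c) :
    Integrable (fun z : ℂ => Real.exp (-c * ‖z‖ ^ 2)) cn := by
  -- A non-integrable function has Bochner integral 0 by convention, contradicting the positive
  -- value just computed.
  by_contra h
  have h1 := integral_exp_cn hc
  rw [integral_undef h] at h1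
  have : 0 < (1 + c)⁻¹ := inv_pos.2 (by linarith)
  linarith

instance isProbabilityMeasure_cn : IsProbabilityMeasure cn := by
  have h := integral_exp_cn (c := 0) (by norm_num)
  simp only [neg_zero, zero_mul, Real.exp_zero, integral_const, smul_eq_mul, mul_one, add_zero,
    inv_one] at h
  refine ⟨?_⟩
  rw [measureReal_def] at h
  rw [← ENNReal.ofReal_toReal (a := cn Set.univ) (fun h' => by simp [h'] at h), h]
  simp

/-- Chernoff bound. -/
theorem cn_real_le_of_one_le_exp {S : Set ℂ} {K : ℝ} (hK : 0 ≤ K)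
    (h : ∀ z ∈ S, 1 ≤ K * Real.exp (‖z‖ ^ 2 / 2)) : cn.real S ≤ 2 * K := by
  have hc : (-1 : ℝ) < -(1 / 2) := by norm_num
  have hi := (integrable_exp_cn hc).const_mul K
  have hb : (fun z : ℂ => K * Real.exp (-(-(1 / 2)) * ‖z‖ ^ 2)) =
      fun z : ℂ => K * Real.exp (‖z‖ ^ 2 / 2) := by
    funext z; congr 2; ring
  rw [hb] at hi
  have h1 := mul_meas_ge_le_integral_of_nonneg
    (Eventually.of_forall fun z : ℂ => by positivity) hi 1
  have h2 : ∫ z : ℂ, K * Real.exp (‖z‖ ^ 2 / 2) ∂cn = 2 * K := by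
    rw [← hb, integral_const_mul, integral_exp_cn hc]; ring
  rw [h2, one_mul] at h1
  exact (measureReal_mono h).trans h1

theorem volume_real_closedBall (a : ℂ) {r : ℝ} (hr : 0 ≤ r) :
    volume.real (Metric.closedBall a r) = Real.pi * r ^ 2 := by
  rw [measureReal_def, Complex.volume_closedBall]
  simp [hr]
  ring

theorem cn_real_eq_setIntegral {S : Set ℂ} (hS : MeasurableSet S) :
    cn.real S = ∫ z in S, cnDensity 1 z := by
  rw [measureReal_def, cn, withDensity_apply _ hS,
    integral_eq_lintegral_of_nonneg_ae (Eventually.of_forall cnDensity_one_nonneg)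
      continuous_cnDensity_one.aestronglyMeasurable]

theorem cn_real_le_volume {S : Set ℂ} (hS : MeasurableSet S) (hf : volume S ≠ ⊤) :
    cn.real S ≤ Real.pi⁻¹ * volume.real S := by
  rw [cn_real_eq_setIntegral hS, mul_comm, ← smul_eq_mul, ← setIntegral_const]
  refine integral_mono_of_nonneg (Eventually.of_forall cnDensity_one_nonneg)
    (integrableOn_const hf) (Eventually.of_forall fun z => ?_)
  unfold cnDensity
  have : Real.exp (-‖z‖ ^ 2 / 1) ≤ 1 := Real.exp_le_one_iff.2 (by
    have := sq_nonneg ‖z‖; linarith)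
  simpa using mul_le_of_le_one_right (by positivity : 0 ≤ (Real.pi * 1)⁻¹) this

theorem le_cn_real_closedBall {r : ℝ} (hr : 0 ≤ r) :
    r ^ 2 * Real.exp (-r ^ 2) ≤ cn.real (Metric.closedBall 0 r) := by
  have hfin : volume (Metric.closedBall (0 : ℂ) r) ≠ ⊤ :=
    (isCompact_closedBall (0 : ℂ) r).measure_lt_top.ne
  have h1 : r ^ 2 * Real.exp (-r ^ 2) =
      ∫ _ in Metric.closedBall (0 : ℂ) r, Real.pi⁻¹ * Real.exp (-r ^ 2) := by
    rw [setIntegral_const, volume_real_closedBall _ hr, smul_eq_mul]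
    field_simp
  rw [cn_real_eq_setIntegral Metric.isClosed_closedBall.measurableSet, h1]
  refine setIntegral_mono_on (integrableOn_const hfin)
    (continuous_cnDensity_one.continuousOn.integrableOn_compact (isCompact_closedBall _ _))
    Metric.isClosed_closedBall.measurableSet fun z hz => ?_
  have hz' : ‖z‖ ^ 2 ≤ r ^ 2 := by
    have := mem_closedBall_zero_iff.1 hz
    gcongr
  unfold cnDensity
  rw [mul_one, div_one]
  gcongr

/-! ### A converse for arbitrary decoders -/

/-- Packing: with noise truncated to radius $T$, the received point stays in the disc of radius
$|s|+T$, which the decision regions cut into disjoint pieces. The noise density is at most $1/\pi$,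
so the sum is at most the disc's area over $\pi$. -/
theorem sum_cn_real_correct_le {A : Finset ℂ} (hA : ∀ x ∈ A, ‖x‖ ^ 2 ≤ 1) (s : ℂ) {φ : ℂ → ℂ}
    (hφ : Measurable φ) {T : ℝ} (hT : 0 ≤ T) :
    ∑ a ∈ A, cn.real (Metric.closedBall 0 T ∩ {z | φ (s * a + z) = a}) ≤ (‖s‖ + T) ^ 2 := by
  have hball : volume (Metric.closedBall (0 : ℂ) (‖s‖ + T)) ≠ ⊤ :=
    (isCompact_closedBall _ _).measure_lt_top.ne
  have hmeas (a : ℂ) : MeasurableSet {y | φ y = a} := hφ (measurableSet_singleton a)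
  set G : ℂ → Set ℂ := fun a => Metric.closedBall (0 : ℂ) (‖s‖ + T) ∩ {y | φ y = a} with hG
  have hGfin (a : ℂ) : volume (G a) ≠ ⊤ := measure_ne_top_of_subset Set.inter_subset_left hball
  have hGm (a : ℂ) : MeasurableSet (G a) :=
    Metric.isClosed_closedBall.measurableSet.inter (hmeas a)
  have hterm : ∀ a ∈ A, cn.real (Metric.closedBall 0 T ∩ {z | φ (s * a + z) = a}) ≤
      Real.pi⁻¹ * volume.real (G a) := by
    intro a ha
    have hm : MeasurableSet (Metric.closedBall (0 : ℂ) T ∩ {z | φ (s * a + z) = a}) :=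
      Metric.isClosed_closedBall.measurableSet.inter
        ((hφ.comp (measurable_const_add (s * a))) (measurableSet_singleton a))
    have hsub : Metric.closedBall (0 : ℂ) T ∩ {z | φ (s * a + z) = a} ⊆
        (fun z => s * a + z) ⁻¹' G a := by
      rintro z ⟨hz, hz'⟩
      refine ⟨?_, hz'⟩
      rw [mem_closedBall_zero_iff] at hz ⊢
      have ha1 : ‖a‖ ≤ 1 := by
        have := hA a ha
        rwa [sq_le_one_iff₀ (norm_nonneg _)] at this
      calc ‖s * a + z‖ ≤ ‖s * a‖ + ‖z‖ := norm_add_le _ _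
        _ ≤ ‖s‖ + T := by
          rw [norm_mul]
          have := mul_le_of_le_one_right (norm_nonneg s) ha1
          linarith
    have hpre : volume ((fun z => s * a + z) ⁻¹' G a) = volume (G a) :=
      (measurePreserving_add_left volume (s * a)).measure_preimage (hGm a).nullMeasurableSet
    have hfin : volume ((fun z => s * a + z) ⁻¹' G a) ≠ ⊤ := by rw [hpre]; exact hGfin a
    refine (cn_real_le_volume hm (measure_ne_top_of_subset hsub hfin)).trans ?_
    have := measureReal_mono hsub hfin
    rw [measureReal_def volume (_ ⁻¹' _), hpre, ← measureReal_def] at this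
    gcongr
  refine (Finset.sum_le_sum hterm).trans ?_
  rw [← Finset.mul_sum, ← measureReal_biUnion_finset
    (fun a _ b _ hab => Set.disjoint_left.2 fun y hy hy' => hab (hy.2.symm.trans hy'.2))
    (fun a _ => hGm a) (fun a _ => hGfin a)]
  have : volume.real (⋃ a ∈ A, G a) ≤ Real.pi * (‖s‖ + T) ^ 2 := by
    rw [← volume_real_closedBall 0 (by positivity)]
    exact measureReal_mono (Set.iUnion₂_subset fun a _ => Set.inter_subset_left) hball
  calc Real.pi⁻¹ * volume.real (⋃ a ∈ A, G a) ≤ Real.pi⁻¹ * (Real.pi * (‖s‖ + T) ^ 2) := by gcongr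
    _ = _ := by field_simp

/-- Whatever the decoder, a codebook of `N ≥ 2` points in the unit disc, scaled by `s` with
`|s|² ≤ N / 400`, has average error probability bounded away from zero. -/
theorem le_average_error {A : Finset ℂ} (hA : ∀ x ∈ A, ‖x‖ ^ 2 ≤ 1) (hcard : 2 ≤ A.card) {s : ℂ}
    (hs : ‖s‖ ^ 2 ≤ A.card / 400) {φ : ℂ → ℂ} (hφ : Measurable φ) :
    1 / 50 ≤ (A.card : ℝ)⁻¹ * ∑ a ∈ A, cn.real {z | φ (s * a + z) ≠ a} := by
  have hN : (2 : ℝ) ≤ A.card := by exact_mod_cast hcard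
  -- The noise lies in this ball with probability at least
  -- $\tfrac14e^{-1/4}\ge\tfrac14\cdot\tfrac34=\tfrac3{16}$.
  have hball := le_cn_real_closedBall (r := 1 / 2) (by norm_num)
  have hexp := Real.add_one_le_exp (-(1 / 2 : ℝ) ^ 2)
  have hsum := sum_cn_real_correct_le hA s hφ (T := 1 / 2) (by norm_num)
  have hterm : ∀ a ∈ A, 3 / 16 - cn.real (Metric.closedBall 0 (1 / 2) ∩ {z | φ (s * a + z) = a}) ≤
      cn.real {z | φ (s * a + z) ≠ a} := by
    intro a _
    have h1 := le_measureReal_sdiff (μ := cn) (s₁ := Metric.closedBall 0 (1 / 2))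
      (s₂ := Metric.closedBall 0 (1 / 2) ∩ {z | φ (s * a + z) = a})
    have h2 : cn.real (Metric.closedBall 0 (1 / 2) \
        (Metric.closedBall 0 (1 / 2) ∩ {z | φ (s * a + z) = a})) ≤
        cn.real {z | φ (s * a + z) ≠ a} :=
      measureReal_mono fun z hz h => hz.2 ⟨hz.1, h⟩
    linarith
  have h3 := Finset.sum_le_sum hterm
  rw [Finset.sum_sub_distrib, Finset.sum_const, nsmul_eq_mul] at h3
  -- By $|s|\le 5|s|^2+\tfrac1{20}$ the left side is at most $6|s|^2+\tfrac3{10}$, and $N\ge2$ gives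
  -- $\tfrac3{10}\le\tfrac{3}{20}N$. The margin left is $\tfrac3{16}-\tfrac{33}{200}>\tfrac1{50}$.
  have h4 : (‖s‖ + 1 / 2) ^ 2 ≤ 33 / 200 * A.card := by
    nlinarith [sq_nonneg (‖s‖ - 1 / 10)]
  rw [le_inv_mul_iff₀ (by linarith)]
  linarith

namespace StrippingDecoder

variable {m : NoiseModel} {ρ α : ℝ} {A B : Finset ℂ}

/-! ### Measurability and integrability of the conditional error probabilities -/

theorem measurable_output (D : StrippingDecoder m ρ α A B) :
    Measurable fun p : ℂ × ℂ × ℂ => D.output p.1 p.2.1 p.2.2 := by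
  unfold output
  refine D.measurable_intended.comp (measurable_fst.prodMk ?_)
  have := D.measurable_interferer
  fun_prop

theorem measurable_cn_real_section {X : Type*} [MeasurableSpace X] {f : X × ℂ → ℂ}
    (hf : Measurable f) (a : ℂ) : Measurable fun x => cn.real {z | f (x, z) ≠ a} := by
  have h : MeasurableSet {p | f p ≠ a} := (hf (measurableSet_singleton a)).compl
  exact (measurable_measure_prodMk_left (ν := cn) h).ennreal_toReal

theorem measurable_condError (D : StrippingDecoder m ρ α A B) :
    Measurable fun h : ℂ × ℂ => D.condError h.1 h.2 := by
  unfold condError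
  refine Measurable.const_mul (Finset.measurable_fun_sum _ fun a _ =>
    Finset.measurable_fun_sum _ fun b _ => ?_) _
  refine measurable_cn_real_section (X := ℂ × ℂ) (f := fun p => D.output p.1.1 p.1.2
    ((√ρ : ℂ) * p.1.1 * a + (√(ρ ^ α) : ℂ) * p.1.2 * b + p.2)) ?_ a
  exact D.measurable_output.comp (f := fun p : (ℂ × ℂ) × ℂ => (p.1.1, p.1.2,
    (√ρ : ℂ) * p.1.1 * a + (√(ρ ^ α) : ℂ) * p.1.2 * b + p.2)) (by fun_prop)

/-- Error probability of the second stage given the direct fading coefficient, when the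
interference has been removed. -/
noncomputable def condErrorNoInterference (D : StrippingDecoder m ρ α A B) (g : ℂ) : ℝ :=
  (A.card : ℝ)⁻¹ * ∑ a ∈ A, cn.real {z | D.intended (g, (√ρ : ℂ) * g * a + z) ≠ a}

theorem measurable_condErrorNoInterference (D : StrippingDecoder m ρ α A B) :
    Measurable D.condErrorNoInterference := by
  unfold condErrorNoInterference
  refine Measurable.const_mul (Finset.measurable_fun_sum _ fun a _ => ?_) _
  refine measurable_cn_real_section (f := fun p : ℂ × ℂ =>
    D.intended (p.1, (√ρ : ℂ) * p.1 * a + p.2)) ?_ a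
  exact D.measurable_intended.comp (f := fun p : ℂ × ℂ => (p.1, (√ρ : ℂ) * p.1 * a + p.2))
    (by fun_prop)

theorem average_le {S : Finset ℂ} {f : ℂ → ℝ} {c : ℝ} (hc : 0 ≤ c) (h : ∀ x ∈ S, f x ≤ c) :
    (S.card : ℝ)⁻¹ * ∑ x ∈ S, f x ≤ c := by
  rcases S.eq_empty_or_nonempty with rfl | hS
  · simpa using hc
  · have : (0 : ℝ) < S.card := by exact_mod_cast hS.card_pos
    rw [inv_mul_le_iff₀ this, ← nsmul_eq_mul]
    exact Finset.sum_le_card_nsmul _ _ _ h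

theorem le_average {S : Finset ℂ} (hS : S.Nonempty) {f : ℂ → ℝ} {c : ℝ}
    (h : ∀ x ∈ S, c ≤ f x) : c ≤ (S.card : ℝ)⁻¹ * ∑ x ∈ S, f x := by
  have : (0 : ℝ) < S.card := by exact_mod_cast hS.card_pos
  rw [le_inv_mul_iff₀ this, ← nsmul_eq_mul]
  exact Finset.card_nsmul_le_sum _ _ _ h

theorem condError_eq_average (D : StrippingDecoder m ρ α A B) (g k : ℂ) :
    D.condError g k = (B.card : ℝ)⁻¹ * ∑ b ∈ B, ((A.card : ℝ)⁻¹ * ∑ a ∈ A,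
      cn.real {z | D.output g k ((√ρ : ℂ) * g * a + (√(ρ ^ α) : ℂ) * k * b + z) ≠ a}) := by
  unfold condError
  rw [Finset.sum_comm, ← Finset.mul_sum, mul_inv, mul_comm (A.card : ℝ)⁻¹, mul_assoc]

theorem condError_nonneg (D : StrippingDecoder m ρ α A B) (g k : ℂ) : 0 ≤ D.condError g k := by
  unfold condError
  exact mul_nonneg (by positivity)
    (Finset.sum_nonneg fun _ _ => Finset.sum_nonneg fun _ _ => measureReal_nonneg)

theorem condErrorNoInterference_nonneg (D : StrippingDecoder m ρ α A B) (g : ℂ) :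
    0 ≤ D.condErrorNoInterference g :=
  mul_nonneg (by positivity) (Finset.sum_nonneg fun _ _ => measureReal_nonneg)

theorem condError_le (D : StrippingDecoder m ρ α A B) {g k : ℂ} {c : ℝ} (hc : 0 ≤ c)
    (h : ∀ a ∈ A, ∀ b ∈ B,
      cn.real {z | D.output g k ((√ρ : ℂ) * g * a + (√(ρ ^ α) : ℂ) * k * b + z) ≠ a} ≤ c) :
    D.condError g k ≤ c := by
  rw [condError_eq_average]
  exact average_le hc fun b hb => average_le hc fun a ha => h a ha b hb

theorem integrable_condError (D : StrippingDecoder m ρ α A B) :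
    Integrable (fun h : ℂ × ℂ => D.condError h.1 h.2) (cn.prod cn) := by
  refine Integrable.of_bound D.measurable_condError.aestronglyMeasurable 1
    (Eventually.of_forall fun h => ?_)
  rw [Real.norm_of_nonneg (D.condError_nonneg _ _)]
  exact D.condError_le zero_le_one fun _ _ _ _ => measureReal_le_one

theorem integrable_condErrorNoInterference (D : StrippingDecoder m ρ α A B) :
    Integrable D.condErrorNoInterference cn := by
  refine Integrable.of_bound D.measurable_condErrorNoInterference.aestronglyMeasurable 1
    (Eventually.of_forall fun h => ?_)
  rw [Real.norm_of_nonneg (D.condErrorNoInterference_nonneg _)]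
  exact average_le zero_le_one fun _ _ => measureReal_le_one

/-! ### Lower bounds -/

theorem norm_sqrt_mul_sq (hρ : 0 ≤ ρ) (g : ℂ) : ‖(√ρ : ℂ) * g‖ ^ 2 = ρ * ‖g‖ ^ 2 := by
  rw [norm_mul, mul_pow, Complex.norm_real, Real.norm_of_nonneg (Real.sqrt_nonneg _),
    Real.sq_sqrt hρ]

/-- For fixed $g$, $k$, $b$ the interference is a constant shift; absorbed into the decoder, it
leaves a point-to-point problem to which the packing bound applies. -/
theorem le_condError (D : StrippingDecoder m ρ α A B) (hρ : 0 ≤ ρ)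
    (hA : ∀ x ∈ A, ‖x‖ ^ 2 ≤ 1) (hcard : 2 ≤ A.card) (hB : B.Nonempty) {g : ℂ}
    (hg : ρ * ‖g‖ ^ 2 ≤ A.card / 400) (k : ℂ) : 1 / 50 ≤ D.condError g k := by
  rw [condError_eq_average]
  refine le_average hB fun b _ => ?_
  have hφ : Measurable fun y => D.output g k (y + (√(ρ ^ α) : ℂ) * k * b) :=
    D.measurable_output.comp (f := fun y : ℂ => (g, k, y + (√(ρ ^ α) : ℂ) * k * b)) (by fun_prop)
  have h := le_average_error hA hcard (s := (√ρ : ℂ) * g) (by rwa [norm_sqrt_mul_sq hρ]) hφ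
  simpa only [add_right_comm _ ((√(ρ ^ α) : ℂ) * k * b)] using h

theorem le_condErrorNoInterference (D : StrippingDecoder m ρ α A B) (hρ : 0 ≤ ρ)
    (hA : ∀ x ∈ A, ‖x‖ ^ 2 ≤ 1) (hcard : 2 ≤ A.card) {g : ℂ}
    (hg : ρ * ‖g‖ ^ 2 ≤ A.card / 400) : 1 / 50 ≤ D.condErrorNoInterference g :=
  le_average_error hA hcard (s := (√ρ : ℂ) * g) (by rwa [norm_sqrt_mul_sq hρ])
    (φ := fun y => D.intended (g, y)) (D.measurable_intended.comp (by fun_prop))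

/-- The probability of a deep fade `|g|² ≤ s`. -/
theorem le_cn_real_fade {s : ℝ} (hs : 0 ≤ s) (hs1 : s ≤ 1) :
    s / 3 ≤ cn.real {g : ℂ | ‖g‖ ^ 2 ≤ s} := by
  have h := le_cn_real_closedBall (Real.sqrt_nonneg s)
  have hset : {g : ℂ | ‖g‖ ^ 2 ≤ s} = Metric.closedBall 0 (√s) := by
    ext g
    simp [Real.le_sqrt (norm_nonneg g) hs]
  rw [Real.sq_sqrt hs] at h
  rw [hset]
  refine le_trans ?_ h
  have he : (1 : ℝ) / 3 ≤ Real.exp (-s) := by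
    have h1 : Real.exp (-1) ≤ Real.exp (-s) := Real.exp_le_exp.2 (by linarith)
    have h2 : (1 : ℝ) / 3 ≤ Real.exp (-1) := by
      rw [Real.exp_neg, one_div]
      exact inv_anti₀ (Real.exp_pos 1) (by linarith [Real.exp_one_lt_d9])
    linarith
  nlinarith

theorem measurableSet_fade (s : ℝ) : MeasurableSet {g : ℂ | ‖g‖ ^ 2 ≤ s} :=
  measurableSet_le (by fun_prop) measurable_const

theorem le_integral_of_le_on {X : Type*} [MeasurableSpace X] {μ : Measure X} [IsFiniteMeasure μ]
    {f : X → ℝ} (hf : Integrable f μ) (h0 : ∀ x, 0 ≤ f x) {S : Set X} (hS : MeasurableSet S)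
    {c : ℝ} (hc : ∀ x ∈ S, c ≤ f x) : c * μ.real S ≤ ∫ x, f x ∂μ := by
  have h1 : c * μ.real S = ∫ _ in S, c ∂μ := by
    rw [setIntegral_const, smul_eq_mul, mul_comm]
  rw [h1]
  exact (setIntegral_mono_on (integrableOn_const (measure_ne_top _ _)) hf.integrableOn hS hc).trans
    (setIntegral_le_integral hf (Eventually.of_forall h0))

theorem mul_sq_norm_le_of_mem_fade (hρ : 0 < ρ) {N : ℝ} {g : ℂ}
    (hg : ‖g‖ ^ 2 ≤ min 1 (N / (400 * ρ))) : ρ * ‖g‖ ^ 2 ≤ N / 400 := by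
  have h := hg.trans (min_le_right _ _)
  rw [le_div_iff₀ (by positivity)] at h
  linarith

/-- Fade probability times error during the fade; $150=3\cdot 50$. -/
theorem le_error (D : StrippingDecoder m ρ α A B) (hρ : 0 < ρ)
    (hA : ∀ x ∈ A, ‖x‖ ^ 2 ≤ 1) (hcard : 2 ≤ A.card) (hB : B.Nonempty) :
    1 / 150 * min 1 (A.card / (400 * ρ)) ≤ D.error := by
  set s : ℝ := min 1 (A.card / (400 * ρ)) with hs
  have hs0 : 0 ≤ s := le_min zero_le_one (by positivity)
  have h := le_integral_of_le_on D.integrable_condError (fun _ => D.condError_nonneg _ _)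
    (S := {g : ℂ | ‖g‖ ^ 2 ≤ s} ×ˢ Set.univ) ((measurableSet_fade s).prod MeasurableSet.univ)
    (c := 1 / 50) fun h hh =>
      D.le_condError hρ.le hA hcard hB (mul_sq_norm_le_of_mem_fade hρ hh.1) h.2
  rw [measureReal_prod_prod, probReal_univ, mul_one] at h
  have := le_cn_real_fade hs0 (min_le_left _ _)
  unfold error
  linarith

theorem le_errorNoInterference (D : StrippingDecoder m ρ α A B) (hρ : 0 < ρ)
    (hA : ∀ x ∈ A, ‖x‖ ^ 2 ≤ 1) (hcard : 2 ≤ A.card) :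
    1 / 150 * min 1 (A.card / (400 * ρ)) ≤ D.errorNoInterference := by
  set s : ℝ := min 1 (A.card / (400 * ρ)) with hs
  have hs0 : 0 ≤ s := le_min zero_le_one (by positivity)
  have h := le_integral_of_le_on D.integrable_condErrorNoInterference
    D.condErrorNoInterference_nonneg (measurableSet_fade s) (c := 1 / 50) fun g hg =>
      D.le_condErrorNoInterference hρ.le hA hcard (mul_sq_norm_le_of_mem_fade hρ hg)
  have := le_cn_real_fade hs0 (min_le_left _ _)
  change _ ≤ ∫ g, D.condErrorNoInterference g ∂cn
  linarith

/-! ### Upper bounds -/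

/-- If the nearest-point rule prefers a wrong point, the noise is at least half the distance. -/
theorem sq_norm_le_of_intended_ne (D : StrippingDecoder m ρ α A B) (hρ : 0 ≤ ρ) {Δ : ℝ}
    (hΔ : ∀ x ∈ A, ∀ x' ∈ A, x ≠ x' → Δ ≤ ‖x - x'‖ ^ 2) {a g z : ℂ} (ha : a ∈ A)
    (h : D.intended (g, (√ρ : ℂ) * g * a + z) ≠ a) : ρ * Δ * ‖g‖ ^ 2 ≤ 4 * ‖z‖ ^ 2 := by
  obtain ⟨hmem, hml⟩ := D.intended_ml g ((√ρ : ℂ) * g * a + z)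
  set a' := D.intended (g, (√ρ : ℂ) * g * a + z)
  have h1 := norm_le_of_cnDensity_le one_pos (hml a ha)
  rw [add_sub_cancel_left] at h1
  have h2 : (√ρ : ℂ) * g * (a - a') = ((√ρ : ℂ) * g * a + z - (√ρ : ℂ) * g * a') - z := by ring
  have h3 : ‖(√ρ : ℂ) * g * (a - a')‖ ≤ 2 * ‖z‖ := by
    rw [h2]
    linarith [norm_sub_le ((√ρ : ℂ) * g * a + z - (√ρ : ℂ) * g * a') z]
  have h4 : ‖(√ρ : ℂ) * g * (a - a')‖ ^ 2 ≤ (2 * ‖z‖) ^ 2 := by gcongr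
  rw [norm_mul, mul_pow, norm_sqrt_mul_sq hρ] at h4
  have h5 := mul_le_mul_of_nonneg_left (hΔ a ha a' hmem (Ne.symm h))
    (by positivity : 0 ≤ ρ * ‖g‖ ^ 2)
  linarith

/-- Reduces a comparison of mixture likelihoods to one of single Gaussians: one sum is bounded below
by a single term, the other above by its largest term, at the cost of a factor $|A|$. -/
theorem exists_le_card_mul_cnDensity {g : ℂ} {w w' a : ℂ} (ha : a ∈ A)
    (h : (A.card : ℝ)⁻¹ * ∑ x ∈ A, cnDensity 1 (w - g * x) ≤
      (A.card : ℝ)⁻¹ * ∑ x ∈ A, cnDensity 1 (w' - g * x)) :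
    ∃ a' ∈ A, cnDensity 1 (w - g * a) ≤ A.card * cnDensity 1 (w' - g * a') := by
  have hN : (0 : ℝ) < A.card := by exact_mod_cast Finset.card_pos.2 ⟨a, ha⟩
  have h1 := le_of_mul_le_mul_left h (inv_pos.2 hN)
  obtain ⟨a', ha', hmax⟩ := A.exists_max_image (fun x => cnDensity 1 (w' - g * x)) ⟨a, ha⟩
  refine ⟨a', ha', ?_⟩
  calc cnDensity 1 (w - g * a) ≤ ∑ x ∈ A, cnDensity 1 (w - g * x) :=
        Finset.single_le_sum (f := fun x => cnDensity 1 (w - g * x))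
          (fun _ _ => cnDensity_one_nonneg _) ha
    _ ≤ _ := h1
    _ ≤ _ := by
      rw [← nsmul_eq_mul]
      exact Finset.sum_le_card_nsmul _ _ _ hmax

/-- Taking logarithms leaves the additive loss $\log N\le N$. This crude form suffices because $N$
is later compared with $\rho$, and rates are at most 1. -/
theorem sq_norm_le_of_cnDensity_le {N : ℝ} (hN : 0 < N) {z v : ℂ}
    (h : cnDensity 1 z ≤ N * cnDensity 1 v) : ‖v‖ ^ 2 ≤ ‖z‖ ^ 2 + N := by
  unfold cnDensity at h
  rw [mul_left_comm] at h
  have h1 := le_of_mul_le_mul_left h (by positivity)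
  have h2 := Real.log_le_log (Real.exp_pos _) h1
  rw [Real.log_mul hN.ne' (Real.exp_pos _).ne', Real.log_exp, Real.log_exp, div_one, div_one] at h2
  linarith [Real.log_le_sub_one_of_pos hN]

/-- For both noise models, a wrong decision on the interferer forces a deep fade of the cross
link relative to the intended signal and the noise. -/
theorem sq_norm_le_of_interferer_ne (D : StrippingDecoder m ρ α A B) (hρ : 0 < ρ)
    (hA : ∀ x ∈ A, ‖x‖ ^ 2 ≤ 1) {Δ : ℝ}
    (hΔ : ∀ x ∈ B, ∀ x' ∈ B, x ≠ x' → Δ ≤ ‖x - x'‖ ^ 2) {a b g k z : ℂ} (ha : a ∈ A) (hb : b ∈ B)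
    (h : D.interferer (g, k, (√ρ : ℂ) * g * a + (√(ρ ^ α) : ℂ) * k * b + z) ≠ b) :
    ρ ^ α * Δ * ‖k‖ ^ 2 ≤ 12 * (ρ * ‖g‖ ^ 2 + ‖z‖ ^ 2 + A.card) := by
  obtain ⟨hmem, hml⟩ := D.interferer_ml g k ((√ρ : ℂ) * g * a + (√(ρ ^ α) : ℂ) * k * b + z)
  set b' := D.interferer (g, k, (√ρ : ℂ) * g * a + (√(ρ ^ α) : ℂ) * k * b + z)
  have hml := hml b hb
  have hρα : 0 ≤ ρ ^ α := Real.rpow_nonneg hρ.le _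
  have hN : (0 : ℝ) < A.card := by exact_mod_cast Finset.card_pos.2 ⟨a, ha⟩
  have hsig : ∀ x ∈ A, ‖(√ρ : ℂ) * g * x‖ ≤ √ρ * ‖g‖ := by
    intro x hx
    have hx1 : ‖x‖ ≤ 1 := (sq_le_one_iff₀ (norm_nonneg _)).1 (hA x hx)
    rw [norm_mul, norm_mul, Complex.norm_real, Real.norm_of_nonneg (Real.sqrt_nonneg _)]
    exact mul_le_of_le_one_right (by positivity) hx1
  have hG2 : (√ρ * ‖g‖) ^ 2 = ρ * ‖g‖ ^ 2 := by rw [mul_pow, Real.sq_sqrt hρ.le]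
  suffices hu : ‖(√(ρ ^ α) : ℂ) * k * (b - b')‖ ^ 2 ≤
      12 * (ρ * ‖g‖ ^ 2 + ‖z‖ ^ 2 + A.card) by
    rw [norm_mul, mul_pow, norm_sqrt_mul_sq hρα] at hu
    have h5 := mul_le_mul_of_nonneg_left (hΔ b hb b' hmem (Ne.symm h))
      (by positivity : 0 ≤ ρ ^ α * ‖k‖ ^ 2)
    linarith
  rw [← hG2]
  set G := √ρ * ‖g‖
  have hG : 0 ≤ G := by positivity
  set u := (√(ρ ^ α) : ℂ) * k * (b - b') with hu
  cases m with
  | gaussian =>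
    have h1 := norm_le_of_cnDensity_le (by positivity) hml
    set w := (√ρ : ℂ) * g * a + z with hw
    have e1 : (√ρ : ℂ) * g * a + (√(ρ ^ α) : ℂ) * k * b + z - (√(ρ ^ α) : ℂ) * k * b = w := by
      rw [hw]; ring
    have e2 : (√ρ : ℂ) * g * a + (√(ρ ^ α) : ℂ) * k * b + z - (√(ρ ^ α) : ℂ) * k * b' = u + w := by
      rw [hw, hu]; ring
    rw [e1, e2] at h1
    have h2 : ‖u‖ ≤ 2 * (G + ‖z‖) := by
      have h3 := norm_sub_le (u + w) w
      have h4 := norm_add_le ((√ρ : ℂ) * g * a) z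
      rw [add_sub_cancel_right] at h3
      linarith [hsig a ha]
    have h3 : ‖u‖ ^ 2 ≤ (2 * (G + ‖z‖)) ^ 2 := by gcongr
    nlinarith [sq_nonneg (G - ‖z‖), sq_nonneg G, sq_nonneg ‖z‖]
  | exact =>
    obtain ⟨a', ha', h1⟩ := exists_le_card_mul_cnDensity ha hml
    have h2 := sq_norm_le_of_cnDensity_le hN h1
    set v := (√ρ : ℂ) * g * a + (√(ρ ^ α) : ℂ) * k * b + z - (√(ρ ^ α) : ℂ) * k * b' -
      (√ρ : ℂ) * g * a' with hv
    have e1 : (√ρ : ℂ) * g * a + (√(ρ ^ α) : ℂ) * k * b + z - (√(ρ ^ α) : ℂ) * k * b -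
      (√ρ : ℂ) * g * a = z := by ring
    have e2 : u = v - (√ρ : ℂ) * g * a + (√ρ : ℂ) * g * a' - z := by rw [hu, hv]; ring
    rw [e1] at h2
    have h3 : ‖u‖ ≤ ‖v‖ + 2 * G + ‖z‖ := by
      rw [e2]
      linarith [norm_sub_le (v - (√ρ : ℂ) * g * a + (√ρ : ℂ) * g * a') z,
        norm_add_le (v - (√ρ : ℂ) * g * a) ((√ρ : ℂ) * g * a'),
        norm_sub_le v ((√ρ : ℂ) * g * a), hsig a ha, hsig a' ha']
    have h4 : ‖u‖ ^ 2 ≤ (‖v‖ + 2 * G + ‖z‖) ^ 2 := by gcongr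
    -- $(|v|+2G+|z|)^2\le3(|v|^2+4G^2+|z|^2)$: the constant 12 is this coefficient of $G^2$. The
    -- Gaussian model needs only 8.
    nlinarith [sq_nonneg (‖v‖ - 2 * G), sq_nonneg (‖v‖ - ‖z‖), sq_nonneg (2 * G - ‖z‖),
      sq_nonneg ‖z‖]

theorem cn_real_intended_ne_le (D : StrippingDecoder m ρ α A B) (hρ : 0 ≤ ρ) {Δ : ℝ}
    (hΔ : ∀ x ∈ A, ∀ x' ∈ A, x ≠ x' → Δ ≤ ‖x - x'‖ ^ 2) {a : ℂ} (ha : a ∈ A) (g : ℂ) :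
    cn.real {z | D.intended (g, (√ρ : ℂ) * g * a + z) ≠ a} ≤
      2 * Real.exp (-(ρ * Δ / 8) * ‖g‖ ^ 2) := by
  refine cn_real_le_of_one_le_exp (Real.exp_pos _).le fun z hz => ?_
  rw [← Real.exp_add]
  exact Real.one_le_exp (by linarith [D.sq_norm_le_of_intended_ne hρ hΔ ha hz])

theorem errorNoInterference_le (D : StrippingDecoder m ρ α A B) (hρ : 0 < ρ) {Δ : ℝ} (hΔ0 : 0 < Δ)
    (hΔ : ∀ x ∈ A, ∀ x' ∈ A, x ≠ x' → Δ ≤ ‖x - x'‖ ^ 2) :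
    D.errorNoInterference ≤ 16 / (ρ * Δ) := by
  have hc0 : 0 < ρ * Δ / 8 := by positivity
  have hc : -1 < ρ * Δ / 8 := by linarith
  have h : D.errorNoInterference ≤ ∫ g, 2 * Real.exp (-(ρ * Δ / 8) * ‖g‖ ^ 2) ∂cn :=
    integral_mono D.integrable_condErrorNoInterference ((integrable_exp_cn hc).const_mul 2)
      fun g => average_le (by positivity) fun a ha => D.cn_real_intended_ne_le hρ.le hΔ ha g
  refine h.trans ?_
  rw [integral_const_mul, integral_exp_cn hc, ← div_eq_mul_inv,
    div_le_div_iff₀ (by positivity) (by positivity)]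
  nlinarith

/-- Dividing the first-stage fade condition by $24(\rho+|A|)$ leaves $(|g|^2+|z|^2+1)/2$ on the
right. The $|z|^2$ part is paid by the Chernoff bound, the constant by $e^{1/2}\le2$, and the
$|g|^2$ part stays as $e^{|g|^2/2}$, still integrable against the fading law. -/
theorem cn_real_interferer_ne_le (D : StrippingDecoder m ρ α A B) (hρ : 1 ≤ ρ)
    (hA : ∀ x ∈ A, ‖x‖ ^ 2 ≤ 1) {Δ : ℝ}
    (hΔ : ∀ x ∈ B, ∀ x' ∈ B, x ≠ x' → Δ ≤ ‖x - x'‖ ^ 2) {a b : ℂ} (ha : a ∈ A) (hb : b ∈ B)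
    (g k : ℂ) :
    cn.real {z | D.interferer (g, k, (√ρ : ℂ) * g * a + (√(ρ ^ α) : ℂ) * k * b + z) ≠ b} ≤
      4 * (Real.exp (-(-(1 / 2)) * ‖g‖ ^ 2) *
        Real.exp (-(ρ ^ α * Δ / (24 * (ρ + A.card))) * ‖k‖ ^ 2)) := by
  have hN : (0 : ℝ) ≤ A.card := by positivity
  have hbound : cn.real
      {z | D.interferer (g, k, (√ρ : ℂ) * g * a + (√(ρ ^ α) : ℂ) * k * b + z) ≠ b} ≤
      2 * (Real.exp (1 / 2) * (Real.exp (-(-(1 / 2)) * ‖g‖ ^ 2) *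
        Real.exp (-(ρ ^ α * Δ / (24 * (ρ + A.card))) * ‖k‖ ^ 2))) := by
    refine cn_real_le_of_one_le_exp (by positivity) fun z hz => ?_
    rw [← Real.exp_add, ← Real.exp_add, ← Real.exp_add]
    refine Real.one_le_exp ?_
    have h := D.sq_norm_le_of_interferer_ne (by linarith) hA hΔ ha hb hz
    have h1 : ρ ^ α * Δ / (24 * (ρ + A.card)) * ‖k‖ ^ 2 ≤ (‖g‖ ^ 2 + ‖z‖ ^ 2 + 1) / 2 := by
      rw [div_mul_eq_mul_div, div_le_div_iff₀ (by positivity) two_pos]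
      nlinarith [mul_nonneg hN (sq_nonneg ‖g‖), mul_nonneg hN (sq_nonneg ‖z‖),
        mul_nonneg (sub_nonneg.2 hρ) (sq_nonneg ‖z‖)]
    linarith
  have he : Real.exp (1 / 2) ≤ 2 := by
    have h1 : Real.exp (1 / 2) * Real.exp (1 / 2) = Real.exp 1 := by
      rw [← Real.exp_add]; norm_num
    nlinarith [Real.exp_one_lt_d9, Real.exp_pos (1 / 2 : ℝ)]
  refine hbound.trans ?_
  set X := Real.exp (-(-(1 / 2)) * ‖g‖ ^ 2) *
        Real.exp (-(ρ ^ α * Δ / (24 * (ρ + A.card))) * ‖k‖ ^ 2)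
  have hX : 0 ≤ X := by positivity
  nlinarith

theorem error_le (D : StrippingDecoder m ρ α A B) (hρ : 1 ≤ ρ)
    (hA : ∀ x ∈ A, ‖x‖ ^ 2 ≤ 1) {Δ Δ' : ℝ} (hΔ0 : 0 < Δ) (hΔ0' : 0 < Δ')
    (hΔ : ∀ x ∈ A, ∀ x' ∈ A, x ≠ x' → Δ ≤ ‖x - x'‖ ^ 2)
    (hΔ' : ∀ x ∈ B, ∀ x' ∈ B, x ≠ x' → Δ' ≤ ‖x - x'‖ ^ 2) :
    D.error ≤ 16 / (ρ * Δ) + 192 * (ρ + A.card) / (ρ ^ α * Δ') := by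
  have hρ0 : 0 < ρ := by linarith
  have hρα : 0 < ρ ^ α := Real.rpow_pos_of_pos hρ0 _
  set c₁ := ρ * Δ / 8 with hc₁
  set c₂ := ρ ^ α * Δ' / (24 * (ρ + A.card)) with hc₂
  have h1 : 0 < c₁ := by positivity
  have h2 : 0 < c₂ := by positivity
  have hint₀ := integrable_exp_cn (c := -(1 / 2)) (by norm_num)
  have hint₁ := integrable_exp_cn (c := c₁) (by linarith)
  have hint₂ := integrable_exp_cn (c := c₂) (by linarith)
  -- The dummy factor 1 gives the integrand the product form that `integral_prod_mul` needs.
  have hi₁ : Integrable (fun h : ℂ × ℂ => 2 * (Real.exp (-c₁ * ‖h.1‖ ^ 2) * (1 : ℝ)))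
      (cn.prod cn) := (hint₁.mul_prod (integrable_const (1 : ℝ))).const_mul 2
  have hi₂ : Integrable (fun h : ℂ × ℂ => 4 * (Real.exp (-(-(1 / 2)) * ‖h.1‖ ^ 2) *
      Real.exp (-c₂ * ‖h.2‖ ^ 2))) (cn.prod cn) := (hint₀.mul_prod hint₂).const_mul 4
  have h : D.error ≤ ∫ h : ℂ × ℂ, (2 * (Real.exp (-c₁ * ‖h.1‖ ^ 2) * 1) +
      4 * (Real.exp (-(-(1 / 2)) * ‖h.1‖ ^ 2) * Real.exp (-c₂ * ‖h.2‖ ^ 2))) ∂(cn.prod cn) := by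
    refine integral_mono D.integrable_condError (hi₁.add hi₂) fun h => ?_
    refine D.condError_le (by positivity) fun a ha b hb => ?_
    -- Union bound: if the interferer is decoded correctly, the second stage sees exactly the
    -- interference-free signal.
    have hsub : {z | D.output h.1 h.2
        ((√ρ : ℂ) * h.1 * a + (√(ρ ^ α) : ℂ) * h.2 * b + z) ≠ a} ⊆
        {z | D.intended (h.1, (√ρ : ℂ) * h.1 * a + z) ≠ a} ∪
        {z | D.interferer (h.1, h.2,
          (√ρ : ℂ) * h.1 * a + (√(ρ ^ α) : ℂ) * h.2 * b + z) ≠ b} := by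
      intro z hz
      by_cases hb' : D.interferer (h.1, h.2,
          (√ρ : ℂ) * h.1 * a + (√(ρ ^ α) : ℂ) * h.2 * b + z) = b
      · left
        change D.intended (h.1, _ - (√(ρ ^ α) : ℂ) * h.2 * D.interferer _) ≠ a at hz
        rwa [hb', add_right_comm, add_sub_cancel_right] at hz
      · exact Or.inr hb'
    refine (measureReal_mono hsub).trans ((measureReal_union_le _ _).trans (add_le_add ?_ ?_))
    · rw [mul_one]
      exact D.cn_real_intended_ne_le hρ0.le hΔ ha _
    · exact D.cn_real_interferer_ne_le hρ hA hΔ' ha hb _ _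
  refine h.trans ?_
  rw [integral_add hi₁ hi₂, integral_const_mul, integral_const_mul,
    integral_prod_mul (fun g : ℂ => Real.exp (-c₁ * ‖g‖ ^ 2)) (fun _ => (1 : ℝ)),
    integral_prod_mul (fun g : ℂ => Real.exp (-(-(1 / 2)) * ‖g‖ ^ 2))
      (fun k : ℂ => Real.exp (-c₂ * ‖k‖ ^ 2)),
    integral_exp_cn (by linarith), integral_exp_cn (by norm_num), integral_exp_cn (by linarith)]
  simp only [integral_const, probReal_univ, smul_eq_mul, mul_one]
  have b₁ : (1 + c₁)⁻¹ ≤ c₁⁻¹ := inv_anti₀ h1 (by linarith)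
  have b₂ : (1 + c₂)⁻¹ ≤ c₂⁻¹ := inv_anti₀ h2 (by linarith)
  have e₁ : 2 * c₁⁻¹ = 16 / (ρ * Δ) := by rw [hc₁]; field_simp; norm_num
  have e₂ : 8 * c₂⁻¹ = 192 * (ρ + A.card) / (ρ ^ α * Δ') := by rw [hc₂]; field_simp; norm_num
  rw [← e₁, ← e₂]
  have e₃ : ((1 : ℝ) + -(1 / 2))⁻¹ = 2 := by norm_num
  rw [e₃]
  linarith

end StrippingDecoder

/-! ### Exponential orders -/

theorem eventually_log_rpow_div_log (x : ℝ) :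
    ∀ᶠ ρ : ℝ in atTop, Real.log (ρ ^ x) / Real.log ρ = x := by
  filter_upwards [eventually_gt_atTop 1] with ρ hρ
  rw [Real.log_rpow (by linarith), mul_div_cancel_right₀ _ (Real.log_pos hρ).ne']

/-- Together with `ExpEq.forall_bounds`, this trades limits of log ratios for power bounds with
arbitrarily small loss $\delta$ in the exponent. -/
theorem expEq_rpow_of_forall_bounds {f : ℝ → ℝ} {x : ℝ}
    (h : ∀ δ > 0, ∀ᶠ ρ in atTop, ρ ^ (x - δ) ≤ f ρ ∧ f ρ ≤ ρ ^ (x + δ)) :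
    ExpEq f (fun ρ => ρ ^ x) := by
  refine ⟨?_, ?_, x, ?_, ?_⟩
  · filter_upwards [h 1 one_pos, eventually_gt_atTop 0] with ρ h1 hρ
    exact (Real.rpow_pos_of_pos hρ _).trans_le h1.1
  · filter_upwards [eventually_gt_atTop 0] with ρ hρ using Real.rpow_pos_of_pos hρ _
  · rw [Metric.tendsto_nhds]
    intro δ hδ
    filter_upwards [h (δ / 2) (by positivity), eventually_gt_atTop 1] with ρ h1 hρ
    have hρ0 : 0 < ρ := by linarith
    have hlog := Real.log_pos hρ
    have hp := Real.rpow_pos_of_pos hρ0 (x - δ / 2)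
    have h2 := Real.log_le_log hp h1.1
    have h3 := Real.log_le_log (hp.trans_le h1.1) h1.2
    rw [Real.log_rpow hρ0] at h2 h3
    rw [← le_div_iff₀ hlog] at h2
    rw [← div_le_iff₀ hlog] at h3
    rw [Real.dist_eq, abs_lt]
    constructor <;> linarith
  · exact tendsto_const_nhds.congr' ((eventually_log_rpow_div_log x).mono fun _ h => h.symm)

theorem ExpEq.forall_bounds {f : ℝ → ℝ} {x : ℝ} (h : ExpEq f (fun ρ => ρ ^ x)) {δ : ℝ}
    (hδ : 0 < δ) : ∀ᶠ ρ in atTop, ρ ^ (x - δ) ≤ f ρ ∧ f ρ ≤ ρ ^ (x + δ) := by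
  obtain ⟨hf, -, c, hc, hc'⟩ := h
  have hcx : c = x := tendsto_nhds_unique hc'
    (tendsto_const_nhds.congr' ((eventually_log_rpow_div_log x).mono fun _ h => h.symm))
  subst hcx
  filter_upwards [hf, Metric.tendsto_nhds.1 hc δ hδ, eventually_gt_atTop 1] with ρ h1 h2 hρ
  have hlog := Real.log_pos hρ
  rw [Real.dist_eq, abs_lt] at h2
  rw [← Real.log_le_log_iff (Real.rpow_pos_of_pos (by linarith) _) h1, ← Real.log_le_log_iff h1
    (Real.rpow_pos_of_pos (by linarith) _), Real.log_rpow (by linarith),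
    Real.log_rpow (by linarith), ← le_div_iff₀ hlog, ← div_le_iff₀ hlog]
  constructor <;> linarith

theorem eventually_const_mul_rpow_le (c x : ℝ) {δ : ℝ} (hδ : 0 < δ) :
    ∀ᶠ ρ : ℝ in atTop, c * ρ ^ x ≤ ρ ^ (x + δ) := by
  filter_upwards [(tendsto_rpow_atTop hδ).eventually_ge_atTop c, eventually_gt_atTop 0] with ρ h hρ
  rw [Real.rpow_add hρ, mul_comm]
  exact mul_le_mul_of_nonneg_left h (Real.rpow_pos_of_pos hρ _).le

theorem MinDistExpGe.eventually_rpow_le {C : ℝ → Finset ℂ} {r ε : ℝ} (hε : 0 ≤ ε)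
    (h : MinDistExpGe C (-r + ε)) {δ : ℝ} (hδ : 0 < δ) :
    ∀ᶠ ρ in atTop, ∀ x ∈ C ρ, ∀ x' ∈ C ρ, x ≠ x' → ρ ^ (-r - δ) ≤ ‖x - x'‖ ^ 2 := by
  filter_upwards [h δ hδ, eventually_ge_atTop 1] with ρ h1 hρ x hx x' hx' hne
  exact (Real.rpow_le_rpow_of_exponent_le hρ (by linarith)).trans (h1 x hx x' hx' hne)

/-! ### Diversity orders -/

section

variable {α r s ε e : ℝ} {C C' : ℝ → Finset ℂ} {m : NoiseModel}

theorem eventually_errorNoInterference_le (hε : 0 ≤ ε) (hΔ : MinDistExpGe C (-r + ε))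
    (D : ∀ ρ, StrippingDecoder m ρ α (C ρ) (C' ρ)) (he : e ≤ 1 - r) {δ : ℝ} (hδ : 0 < δ) :
    ∀ᶠ ρ in atTop, (D ρ).errorNoInterference ≤ ρ ^ (-e + δ) := by
  have hδ2 : 0 < δ / 2 := by positivity
  filter_upwards [hΔ.eventually_rpow_le hε hδ2, eventually_ge_atTop 1,
    eventually_const_mul_rpow_le 16 (-e + δ / 2) hδ2] with ρ h1 hρ h2
  have hρ0 : 0 < ρ := by linarith
  have h3 := (D ρ).errorNoInterference_le hρ0 (Real.rpow_pos_of_pos hρ0 _) h1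
  have h4 : 16 / (ρ * ρ ^ (-r - δ / 2)) = 16 * ρ ^ (-(1 + (-r - δ / 2))) := by
    rw [Real.rpow_neg hρ0.le, Real.rpow_add hρ0, Real.rpow_one, div_eq_mul_inv]
  have h5 : ρ ^ (-(1 + (-r - δ / 2))) ≤ ρ ^ (-e + δ / 2) :=
    Real.rpow_le_rpow_of_exponent_le hρ (by linarith)
  rw [add_assoc, add_halves] at h2
  linarith

theorem eventually_error_le (hα : 2 ≤ α) (hr : r ≤ 1) (hε : 0 ≤ ε)
    (hC : IsCodebookFamily r C) (hΔ : MinDistExpGe C (-r + ε)) (hΔ' : MinDistExpGe C' (-s + ε))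
    (D : ∀ ρ, StrippingDecoder m ρ α (C ρ) (C' ρ)) (he : e ≤ 1 - r) (he' : e ≤ 1 - s)
    {δ : ℝ} (hδ : 0 < δ) : ∀ᶠ ρ in atTop, (D ρ).error ≤ ρ ^ (-e + δ) := by
  have hδ3 : 0 < δ / 3 := by positivity
  filter_upwards [hΔ.eventually_rpow_le hε hδ3, hΔ'.eventually_rpow_le hε hδ3,
    eventually_ge_atTop 1, hC.card.forall_bounds hδ3,
    -- $400=16+2\cdot192$ collects the constants of both error terms. The three shares of $\delta$
    -- pay for the minimum distance, the codebook size and this constant.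
    eventually_const_mul_rpow_le 400 (-e + 2 * (δ / 3)) hδ3] with ρ h1 h1' hρ hN h2
  have hρ0 : 0 < ρ := by linarith
  have h3 := (D ρ).error_le hρ (hC.power ρ) (Real.rpow_pos_of_pos hρ0 _)
    (Real.rpow_pos_of_pos hρ0 _) h1 h1'
  have h4 : 16 / (ρ * ρ ^ (-r - δ / 3)) ≤ 16 * ρ ^ (-e + 2 * (δ / 3)) := by
    have h5 : 16 / (ρ * ρ ^ (-r - δ / 3)) = 16 * ρ ^ (-(1 + (-r - δ / 3))) := by
      rw [Real.rpow_neg hρ0.le, Real.rpow_add hρ0, Real.rpow_one, div_eq_mul_inv]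
    rw [h5]
    gcongr
    linarith
  have hN1 : ((C ρ).card : ℝ) ≤ ρ ^ (1 + δ / 3) :=
    hN.2.trans (Real.rpow_le_rpow_of_exponent_le hρ (by linarith))
  have hρ1 : ρ ≤ ρ ^ (1 + δ / 3) := by
    simpa using Real.rpow_le_rpow_of_exponent_le hρ (by linarith : 1 ≤ 1 + δ / 3)
  have h6 : 192 * (ρ + (C ρ).card) / (ρ ^ α * ρ ^ (-s - δ / 3)) ≤
      384 * ρ ^ (-e + 2 * (δ / 3)) := by
    rw [div_le_iff₀ (by positivity), ← Real.rpow_add hρ0, mul_assoc, ← Real.rpow_add hρ0]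
    -- Very strong interference enters here: with $e\le1-s$, the exponents compare because
    -- $\alpha\ge2$.
    have h7 : ρ ^ (1 + δ / 3) ≤ ρ ^ (-e + 2 * (δ / 3) + (α + (-s - δ / 3))) :=
      Real.rpow_le_rpow_of_exponent_le hρ (by linarith)
    linarith
  have h8 : -e + 2 * (δ / 3) + δ / 3 = -e + δ := by ring
  rw [h8] at h2
  linarith

/-- To exponential order the larger of the two rates is attained by a codebook with at least two
elements. -/
theorem eventually_two_le_card_and_rpow_le (hC : IsCodebookFamily r C)
    (hC' : IsCodebookFamily s C')
    (h2 : ∀ᶠ ρ in atTop, 2 ≤ (C ρ).card ∨ 2 ≤ (C' ρ).card) {δ : ℝ} (hδ : 0 < δ) :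
    ∀ᶠ ρ in atTop, (2 ≤ (C ρ).card ∧ ρ ^ (max r s - δ) ≤ (C ρ).card) ∨
      (2 ≤ (C' ρ).card ∧ ρ ^ (max r s - δ) ≤ (C' ρ).card) := by
  have key : ∀ {t : ℝ} {F : ℝ → Finset ℂ}, IsCodebookFamily t F → 0 < t →
      ∀ᶠ ρ in atTop, 2 ≤ (F ρ).card ∧ ρ ^ (t - δ) ≤ (F ρ).card := by
    intro t F hF ht
    filter_upwards [hF.card.forall_bounds hδ, hF.card.forall_bounds (half_pos ht),
      (tendsto_rpow_atTop (half_pos ht)).eventually_ge_atTop 2] with ρ h3 h4 h5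
    refine ⟨?_, h3.1⟩
    rw [sub_half] at h4
    exact_mod_cast h5.trans h4.1
  rcases le_or_gt (max r s) 0 with hle | hpos
  -- At rate zero, cardinality growth cannot provide two codewords, so the assumption on the
  -- codebooks must. At positive rate the growth itself does.
  · filter_upwards [h2, eventually_ge_atTop 1] with ρ h3 hρ
    have h4 : ρ ^ (max r s - δ) ≤ 1 := Real.rpow_le_one_of_one_le_of_nonpos hρ (by linarith)
    have h5 : ∀ n : ℕ, 2 ≤ n → ρ ^ (max r s - δ) ≤ n := fun n hn => by
      have : (2 : ℝ) ≤ n := by exact_mod_cast hn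
      linarith
    exact h3.imp (fun h => ⟨h, h5 _ h⟩) (fun h => ⟨h, h5 _ h⟩)
  · rcases le_total r s with h | h
    · rw [max_eq_right h] at hpos ⊢
      exact (key hC' hpos).mono fun _ => Or.inr
    · rw [max_eq_left h] at hpos ⊢
      exact (key hC hpos).mono fun _ => Or.inl

/-- Kept abstract in $P,P'$ so that it serves both the full error and the second-stage error. -/
theorem eventually_rpow_le_max {P P' : ℝ → ℝ} (hC : IsCodebookFamily r C)
    (hC' : IsCodebookFamily s C')
    (h2 : ∀ᶠ ρ in atTop, 2 ≤ (C ρ).card ∨ 2 ≤ (C' ρ).card) (he : max r s ≤ 1)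
    (hP : ∀ ρ, 0 < ρ → 2 ≤ (C ρ).card → 1 / 150 * min 1 ((C ρ).card / (400 * ρ)) ≤ P ρ)
    (hP' : ∀ ρ, 0 < ρ → 2 ≤ (C' ρ).card → 1 / 150 * min 1 ((C' ρ).card / (400 * ρ)) ≤ P' ρ)
    {δ : ℝ} (hδ : 0 < δ) : ∀ᶠ ρ in atTop, ρ ^ (-(1 - max r s) - δ) ≤ max (P ρ) (P' ρ) := by
  have hδ2 : 0 < δ / 2 := by positivity
  filter_upwards [eventually_two_le_card_and_rpow_le hC hC' h2 hδ2, eventually_ge_atTop 1,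
    -- $60000=150\cdot400$, the two constants of the fade bound.
    eventually_const_mul_rpow_le 60000 (-(1 - max r s) - δ) hδ2] with ρ h3 hρ h4
  have hρ0 : 0 < ρ := by linarith
  have key : ∀ n : ℕ, ρ ^ (max r s - δ / 2) ≤ n →
      ρ ^ (-(1 - max r s) - δ) ≤ 1 / 150 * min 1 (n / (400 * ρ)) := by
    intro n hn
    have h5 : -(1 - max r s) - δ + δ / 2 = (max r s - δ / 2) - 1 := by ring
    rw [h5, Real.rpow_sub_one hρ0.ne'] at h4
    have h6 : ρ ^ (max r s - δ / 2) / ρ ≤ n / ρ := by gcongr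
    have h7 : ρ ^ (-(1 - max r s) - δ) ≤ 1 := Real.rpow_le_one_of_one_le_of_nonpos hρ (by linarith)
    have h9 : ρ ^ (max r s - δ / 2) / ρ ≤ 1 := by
      rw [← Real.rpow_sub_one hρ0.ne']
      exact Real.rpow_le_one_of_one_le_of_nonpos hρ (by linarith)
    have h8 : 150 * ρ ^ (-(1 - max r s) - δ) ≤ min 1 (n / (400 * ρ)) := by
      refine le_min (by linarith) ?_
      rw [mul_comm 400 ρ, ← div_div, le_div_iff₀ (by norm_num)]
      linarith
    linarith
  rcases h3 with h3 | h3
  · exact (key _ h3.2).trans ((hP ρ hρ0 h3.1).trans (le_max_left _ _))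
  · exact (key _ h3.2).trans ((hP' ρ hρ0 h3.1).trans (le_max_right _ _))

end

end FadingIC

open FadingIC
theorem theorem1 (α r₁ r₂ ε : ℝ) (hα : 2 ≤ α)
    (hr₁ : 0 ≤ r₁ ∧ r₁ ≤ 1) (hr₂ : 0 ≤ r₂ ∧ r₂ ≤ 1) (hε : 0 ≤ ε)
    (C₁ C₂ : ℝ → Finset ℂ)
    (hC₁ : IsCodebookFamily r₁ C₁) (hC₂ : IsCodebookFamily r₂ C₂)
    (hC : ∀ᶠ ρ in atTop, 2 ≤ (C₁ ρ).card ∨ 2 ≤ (C₂ ρ).card)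
    (hΔ₁ : MinDistExpGe C₁ (-r₁ + ε)) (hΔ₂ : MinDistExpGe C₂ (-r₂ + ε))
    (m : NoiseModel)
    (D₁ : ∀ ρ, StrippingDecoder m ρ α (C₁ ρ) (C₂ ρ))
    (D₂ : ∀ ρ, StrippingDecoder m ρ α (C₂ ρ) (C₁ ρ)) :
    ExpEq (fun ρ => max (D₁ ρ).error (D₂ ρ).error)
        (fun ρ => ρ ^ (-min (max (1 - r₁) 0) (max (1 - r₂) 0))) ∧
      ExpEq (fun ρ => max (D₁ ρ).errorNoInterference (D₂ ρ).errorNoInterference)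
        (fun ρ => ρ ^ (-min (max (1 - r₁) 0) (max (1 - r₂) 0))) := by
  have hmin : min (max (1 - r₁) 0) (max (1 - r₂) 0) = 1 - max r₁ r₂ := by
    rw [max_eq_left (by linarith [hr₁.2]), max_eq_left (by linarith [hr₂.2]), min_sub_sub_left]
  have he₁ : 1 - max r₁ r₂ ≤ 1 - r₁ := by linarith [le_max_left r₁ r₂]
  have he₂ : 1 - max r₁ r₂ ≤ 1 - r₂ := by linarith [le_max_right r₁ r₂]
  have hmax : max r₁ r₂ ≤ 1 := max_le hr₁.2 hr₂.2
  rw [hmin]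
  refine ⟨expEq_rpow_of_forall_bounds fun δ hδ => ?_,
    expEq_rpow_of_forall_bounds fun δ hδ => ?_⟩
  · exact (eventually_rpow_le_max hC₁ hC₂ hC hmax
      (fun ρ hρ h => (D₁ ρ).le_error hρ (hC₁.power ρ) h (hC₂.nonempty ρ))
      (fun ρ hρ h => (D₂ ρ).le_error hρ (hC₂.power ρ) h (hC₁.nonempty ρ)) hδ).and
      (((eventually_error_le hα hr₁.2 hε hC₁ hΔ₁ hΔ₂ D₁ he₁ he₂ hδ).and
        (eventually_error_le hα hr₂.2 hε hC₂ hΔ₂ hΔ₁ D₂ he₂ he₁ hδ)).mono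
        fun ρ h => max_le h.1 h.2)
  · exact (eventually_rpow_le_max hC₁ hC₂ hC hmax
      (fun ρ hρ h => (D₁ ρ).le_errorNoInterference hρ (hC₁.power ρ) h)
      (fun ρ hρ h => (D₂ ρ).le_errorNoInterference hρ (hC₂.power ρ) h) hδ).and
      (((eventually_errorNoInterference_le hε hΔ₁ D₁ he₁ hδ).and
        (eventually_errorNoInterference_le hε hΔ₂ D₂ he₂ hδ)).mono
        fun ρ h => max_le h.1 h.2)
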